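/- For a cardinal $\Theta$, $H(\Theta)$ is the set of all sets whose transitive closure has cardinality less than $\Theta$. A set $M$ is \emph{weakly closed} if for every regular infinite cardinal $\tau$ and every $I\subseteq M$ with $|I|=\tau$ there is $J\subseteq I$ with $|J|=\tau$ such that every $K\subseteq J$ with $|K|<\tau$ is an element of $M$. A sequence $\langle M_\xi : \xi<\alpha\rangle$ is an \emph{$\in$-chain} if $M_\xi\subseteq M_\eta$ for all $\xi<\eta<\alpha$ and $\langle M_\xi : \xi\le\eta\rangle\in M_{\eta+1}$ whenever $\eta+1<\alpha$; it is \emph{continuous} if $M_\delta=\bigcup_{\xi<\delta}M_\xi$ for every limit ordinal $\delta<\alpha$. The \emph{Closed Continuous $\in$-chain Axiom} (CECA) is the following statement: for every uncountable cardinal $\lambda$, every regular cardinal $\Theta>\lambda$ and all $A,B\in H(\Theta)$ with $|A|=\lambda$ and $|B|<\lambda$, there is a continuous $\in$-chain $\langle M_\xi : \xi<\mathrm{cf}(\lambda)\rangle$ of weakly closed elementary submodels of $(H(\Theta),\in)$ such that $|M_\xi|<\lambda$ for every $\xi<\mathrm{cf}(\lambda)$, $B\in M_0$, and $A\subseteq\bigcup_{\xi<\mathrm{cf}(\lambda)}M_\xi$.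 A base $\mathcal B$ of a topological space $X$ is \emph{$<\omega$-weakly uniform} if every infinite $A\subseteq X$ has a finite subset $F$ such that $\{B\in\mathcal B : F\subseteq B\}$ is finite. It is \emph{point-countable} if every point of $X$ belongs to at most countably many members of $\mathcal B$. \textbf{Theorem.} Assume CECA. Let $X$ be a $T_1$ space in which every non-isolated point $x$ is a cluster point of a countable set $C\subseteq X$ (that is, $x\in\overline{C\setminus\{x\}}$), and suppose that $X$ has a $<\omega$-weakly uniform base. Then $X$ has a point-countable base. -/

import Mathlib

universe u

open Cardinal Topology

namespace WeaklyUniform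

/-! ### The first-order language of set theory and elementary submodels -/

/-- The relation symbols of the language of set theory: one binary symbol. -/
inductive SetRel : ℕ → Type
  | mem : SetRel 2

/-- The first-order language of set theory. -/
def setLang : FirstOrder.Language.{0, 0} := ⟨fun _ => Empty, SetRel⟩

/-- Every collection of sets is a structure for the language of set theory, the binary
symbol being interpreted as true membership. -/
instance memStructure (S : Set ZFSet.{u}) : setLang.Structure S where
  funMap := fun f => Empty.elim f
  RelMap := fun r => match r with
    | SetRel.mem => fun x => (x 0 : ZFSet.{u}) ∈ (x 1 : ZFSet.{u})

/-- `(M, ∈)` is an elementary submodel of `(N, ∈)`: `M ⊆ N`, and the inclusion map is an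
elementary embedding. -/
def IsElementarySubmodel (M N : Set ZFSet.{u}) : Prop :=
  ∃ f : FirstOrder.Language.ElementaryEmbedding setLang M N,
    ∀ x : M, (f x : ZFSet.{u}) = (x : ZFSet.{u})

/-- `H(Θ)`: the sets whose transitive closure has cardinality less than `Θ`. (The transitive
closure of `x` is the least transitive set that includes `x`, so its cardinality is less than `Θ`
exactly if some transitive set that includes `x` has cardinality less than `Θ`.) -/
def H (Θ : Cardinal.{u}) : Set ZFSet.{u} :=
  {x | ∃ t : ZFSet.{u}, t.IsTransitive ∧ x ⊆ t ∧ t.card < Θ}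

/-! ### Weakly closed sets and chains -/

/-- `M` is weakly `τ`-closed: every `I ∈ [M]^τ` has a subset `J ∈ [I]^τ` with `[J]^{<τ} ⊆ M`. -/
def IsWeaklyClosedAt (τ : Cardinal.{u}) (M : ZFSet.{u}) : Prop :=
  ∀ I : ZFSet.{u}, I ⊆ M → I.card = τ →
    ∃ J : ZFSet.{u}, J ⊆ I ∧ J.card = τ ∧ ∀ K : ZFSet.{u}, K ⊆ J → K.card < τ → K ∈ M

/-- `M` is weakly closed: it is weakly `τ`-closed for all regular (infinite) cardinals `τ`. -/
def IsWeaklyClosed (M : ZFSet.{u}) : Prop :=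
  ∀ τ : Cardinal.{u}, τ.IsRegular → IsWeaklyClosedAt τ M

/-- The sequence `⟨M ξ : ξ ≤ η⟩` as a set, namely the set of the ordered pairs `(ξ, M ξ)`. -/
noncomputable def initialSeq (M : Ordinal.{u} → ZFSet.{u}) (η : Ordinal.{u}) : ZFSet.{u} :=
  ZFSet.range fun ξ : Set.Iic η => ZFSet.pair (Ordinal.toZFSet ξ) (M ξ)

/-- `⟨M ξ : ξ < α⟩` is an `∈`-chain (only the values at ordinals below `α` matter). -/
structure IsMemChain (α : Ordinal.{u}) (M : Ordinal.{u} → ZFSet.{u}) : Prop where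
  mono : ∀ ξ η : Ordinal.{u}, ξ < η → η < α → M ξ ⊆ M η
  seq_mem : ∀ η : Ordinal.{u}, η + 1 < α → initialSeq M η ∈ M (η + 1)

/-- `⟨M ξ : ξ < α⟩` is continuous: at limit ordinals it takes unions. -/
def IsContinuousSeq (α : Ordinal.{u}) (M : Ordinal.{u} → ZFSet.{u}) : Prop :=
  ∀ δ : Ordinal.{u}, δ < α → Order.IsSuccLimit δ → ∀ x, x ∈ M δ ↔ ∃ ξ < δ, x ∈ M ξ

/-- The Closed Continuous `∈`-chain Axiom for `lam`. Since the models lie in `H(Θ)` and have to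
contain one another, `Θ` is regular, and the sets `A`, `B` are taken from `H(Θ)` (`A ⊆ H(Θ)` is the
same as `A ∈ H(Θ)` here). -/
def CECAFor (lam : Cardinal.{u}) : Prop :=
  ∀ Θ : Cardinal.{u}, Θ.IsRegular → lam < Θ →
    ∀ A B : ZFSet.{u}, A ∈ H Θ → B ∈ H Θ → A.card = lam → B.card < lam →
      ∃ M : Ordinal.{u} → ZFSet.{u},
        IsMemChain lam.ord.cof.ord M ∧
        IsContinuousSeq lam.ord.cof.ord M ∧
        (∀ ξ < lam.ord.cof.ord,
          IsElementarySubmodel (M ξ : Set ZFSet.{u}) (H Θ) ∧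
          IsWeaklyClosed (M ξ) ∧
          (M ξ).card < lam) ∧
        B ∈ M 0 ∧
        ∀ a ∈ A, ∃ ξ < lam.ord.cof.ord, a ∈ M ξ

/-- The Closed Continuous `∈`-chain Axiom. -/
def CECA : Prop :=
  ∀ lam : Cardinal.{u}, ℵ₀ < lam → CECAFor lam

/-! ### Bases -/

/-- `𝓑` is a `<ω`-weakly uniform base for `X`. -/
structure IsLtOmegaWeaklyUniformBase {X : Type u} [TopologicalSpace X]
    (𝓑 : Set (Set X)) : Prop where
  isBase : TopologicalSpace.IsTopologicalBasis 𝓑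
  weaklyUniform : ∀ A : Set X, A.Infinite →
    ∃ F : Set X, F ⊆ A ∧ F.Finite ∧ {B | B ∈ 𝓑 ∧ F ⊆ B}.Finite

/-- `𝓑` is a point-countable base for `X`. -/
structure IsPointCountableBase {X : Type u} [TopologicalSpace X]
    (𝓑 : Set (Set X)) : Prop where
  isBase : TopologicalSpace.IsTopologicalBasis 𝓑
  pointCountable : ∀ x : X, {B | B ∈ 𝓑 ∧ x ∈ B}.Countable

end WeaklyUniform

/-!
Write `𝓑` for the weakly uniform base. If a non-isolated point `x` is a cluster point of a countable
set `C`, every member of `𝓑` at `x` includes one of the countably many finite subsets of `C` that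
lie in only finitely many members; so `𝓑` is already point-countable at `x`
(`IsLtOmegaWeaklyUniformBase.countable_of_accPt`). At the isolated points it is enough to remove
from each member of `𝓑` a finite set of isolated points and to add the singletons
(`isTopologicalBasis_diff_isolated`), provided the finite sets can be chosen so that the diminished
members are point-countable.

That choice is possible for every weakly uniform family `r` of sets, by induction on the cardinality
`λ` of the points and members involved (`CECA.exists_finite_countable`). CECA splits points and
members along a continuous chain of models `M ξ` of size less than `λ`, and elementarity controls the
interaction between different layers:

* a member of `r` outside `M ξ` meets `M ξ` in a finite set, since a finite subset of `M ξ` that lies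
  in only finitely many members of `r` has all of these in `M ξ`
  (`IsElementarySubmodel.finite_inter`); this finite set is removed;
* a point outside `M ξ` lies in only countably many members from `M ξ`: among uncountably many, weak
  `ℵ₁`-closedness gives an infinite subfamily that is an element of `M ξ`, its intersection is not
  included in `M ξ`, hence is infinite, and this contradicts weak uniformity
  (`IsElementarySubmodel.countable_of_notMem`).

Within one layer the induction hypothesis applies. Both uses of elementarity are instances of the
fact that an elementary submodel includes the finite sets definable with parameters from it
(`subset_range_of_definable_of_finite`).
-/

/-! ### Finite definable sets in elementary submodels -/

namespace FirstOrder.Language.ElementaryEmbedding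

open Set

/-- The range of an elementary embedding is algebraically closed: it includes every finite set
that is definable with parameters from it. -/
theorem subset_range_of_definable_of_finite
    {L : Language} {M N : Type*} [L.Structure M] [L.Structure N] (f : M ↪ₑ[L] N) {D : Set N}
    (hD : (range f).Definable₁ L D) (hfin : D.Finite) : D ⊆ range f := by
  intro d hd
  by_contra hdM
  -- Only finitely many points of `D` lie in the range, so `D \ range f` is definable too.
  have hE : (range f).Definable₁ L (D \ range f) := by
    have : Finite ↥(D ∩ range f) := hfin.inter_of_left _
    have hS : (range f).Definable L (⋃ s : ↥(D ∩ range f), {x : Fin 1 → N | x 0 ∈ ({s.1} : Set N)}) :=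
      definable_iUnion_of_finite fun s => Definable.singleton_of_mem L s.2.2
    refine (congrArg (Definable _ _) ?_).mp (hD.sdiff hS)
    ext x
    simp +contextual
  obtain ⟨φ, hφ⟩ := definable_iff_exists_formula_sum.1 hE
  have key : ∀ z : Fin 1 → N, φ.Realize (Sum.elim (↑) z) ↔ z 0 ∈ D ∧ z 0 ∉ range f :=
    fun z => (Set.ext_iff.1 hφ z).symm
  choose g hg using fun a : range f => a.2
  have hg' : f ∘ g = ((↑) : range f → N) := funext hg
  have h1 : (φ.iExs (Fin 1)).Realize (f ∘ g) := by
    rw [Formula.realize_iExs, hg']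
    exact ⟨fun _ => d, (key _).2 ⟨hd, hdM⟩⟩
  rw [f.map_formula, Formula.realize_iExs] at h1
  obtain ⟨i, hi⟩ := h1
  rw [← f.map_formula, Sum.comp_elim, hg', key] at hi
  exact hi.2 ⟨_, rfl⟩

end FirstOrder.Language.ElementaryEmbedding

namespace WeaklyUniform

open Set

section Elementary

variable {M N : Set ZFSet.{u}}

/-- The membership symbol. -/
def memSymbol : setLang.Relations 2 := SetRel.mem

/-- The atomic formula `a ∈ b`. -/
def memFormula {α : Type*} (a b : α) : setLang.Formula α :=
  FirstOrder.Language.Relations.formula₂ memSymbol (.var a) (.var b)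

theorem realize_memFormula {α : Type*} (a b : α) (v : α → N) :
    (memFormula a b).Realize v ↔ (v a : ZFSet.{u}) ∈ (v b : ZFSet.{u}) := by
  rw [memFormula, FirstOrder.Language.Formula.realize_rel₂]
  rfl

theorem definable₁_mem_param {A : Set N} {a : N} (ha : a ∈ A) :
    A.Definable₁ setLang {z : N | z.1 ∈ a.1} := by
  refine definable_iff_exists_formula_sum.2 ⟨memFormula (.inr 0) (.inl ⟨a, ha⟩), ?_⟩
  ext v
  rw [mem_ofPred_eq, mem_ofPred_eq, mem_ofPred_eq, realize_memFormula]
  rfl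

theorem definable₁_param_mem {A : Set N} {a : N} (ha : a ∈ A) :
    A.Definable₁ setLang {z : N | a.1 ∈ z.1} := by
  refine definable_iff_exists_formula_sum.2 ⟨memFormula (.inl ⟨a, ha⟩) (.inr 0), ?_⟩
  ext v
  rw [mem_ofPred_eq, mem_ofPred_eq, mem_ofPred_eq, realize_memFormula]
  rfl

theorem definable₁_forall_mem {A : Set N} {k : N} (hk : k ∈ A) :
    A.Definable₁ setLang {z : N | ∀ y : N, y.1 ∈ k.1 → z.1 ∈ y.1} := by
  have hS : A.Definable setLang
      {w : Fin 1 ⊕ Fin 1 → N | (w (.inr 0)).1 ∈ k.1 → (w (.inl 0)).1 ∈ (w (.inr 0)).1} := by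
    refine definable_iff_exists_formula_sum.2
      ⟨(memFormula (.inr (.inr 0)) (.inl ⟨k, hk⟩)).imp
        (memFormula (.inr (.inl 0)) (.inr (.inr 0))), ?_⟩
    ext w
    simp only [mem_ofPred_eq, FirstOrder.Language.Formula.realize_imp, realize_memFormula]
    rfl
  refine (congrArg (Definable _ _) ?_).mp hS.forall_of_finite
  ext v
  exact ⟨fun h y => h fun _ => y, fun h u => h (u 0)⟩

theorem IsElementarySubmodel.subset (h : IsElementarySubmodel M N) : M ⊆ N := by
  obtain ⟨f, hf⟩ := h
  intro x hx
  have := (f ⟨x, hx⟩).2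
  rwa [hf] at this

theorem IsElementarySubmodel.mem_of_definable_of_finite (h : IsElementarySubmodel M N)
    {D : Set N} (hD : {z : N | z.1 ∈ M}.Definable₁ setLang D) (hfin : D.Finite) {z : N}
    (hz : z ∈ D) : z.1 ∈ M := by
  obtain ⟨f, hf⟩ := h
  have hr : range f = {z : N | z.1 ∈ M} := by
    ext z
    constructor
    · rintro ⟨x, rfl⟩
      have := x.2
      rwa [← hf x] at this
    · exact fun hz => ⟨⟨z, hz⟩, Subtype.ext (hf _)⟩
  have := f.subset_range_of_definable_of_finite (hr ▸ hD) hfin hz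
  rwa [hr] at this

theorem IsElementarySubmodel.mem_of_singleton_mem (h : IsElementarySubmodel M N)
    {r : ZFSet.{u}} (hrN : r ∈ N) (hr : {r} ∈ M) : r ∈ M := by
  refine h.mem_of_definable_of_finite
    (definable₁_mem_param (a := (⟨{r}, h.subset hr⟩ : N)) hr) ?_ (z := ⟨r, hrN⟩)
    (ZFSet.mem_singleton.2 rfl)
  refine Set.Subsingleton.finite fun x hx y hy => Subtype.ext ?_
  exact (ZFSet.mem_singleton.1 hx).trans (ZFSet.mem_singleton.1 hy).symm

/-- If only finitely many members of `r ∈ M` include the finite set `F ⊆ M`, all of them are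
in `M`. -/
theorem IsElementarySubmodel.mem_of_finite_superset (h : IsElementarySubmodel M N)
    {r : ZFSet.{u}} (hr : r ∈ M) {F : Set ZFSet.{u}} (hFM : F ⊆ M) (hF : F.Finite)
    (hfin : {y | y ∈ r ∧ F ⊆ y}.Finite) {y : ZFSet.{u}} (hyN : y ∈ N) (hy : y ∈ r)
    (hFy : F ⊆ y) : y ∈ M := by
  have := hF.to_subtype
  refine h.mem_of_definable_of_finite (D := {y : N | y.1 ∈ r ∧ F ⊆ y.1}) ?_
    (hfin.preimage Subtype.val_injective.injOn) (z := ⟨y, hyN⟩) ⟨hy, hFy⟩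
  refine (congrArg (Definable _ _) ?_).mp <|
    (definable₁_mem_param (a := (⟨r, h.subset hr⟩ : N)) (A := {z : N | z.1 ∈ M}) hr).inter <|
      definable_iInter_of_finite fun x : F =>
        definable₁_param_mem (a := (⟨x, h.subset (hFM x.2)⟩ : N)) (hFM x.2)
  ext v
  simp [Set.subset_def]

/-- If only finitely many sets lie in all members of the nonempty set `k ∈ M`, all of them are
in `M`. -/
theorem IsElementarySubmodel.mem_of_finite_forall_mem (h : IsElementarySubmodel M N)
    (hN : ∀ y ∈ N, ∀ x ∈ y, x ∈ N) {k : ZFSet.{u}} (hk : k ∈ M)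
    (hne : ∃ y, y ∈ k) (hfin : {x | ∀ y ∈ k, x ∈ y}.Finite) {x : ZFSet.{u}}
    (hx : ∀ y ∈ k, x ∈ y) : x ∈ M := by
  have hkN := h.subset hk
  obtain ⟨y₀, hy₀⟩ := hne
  refine h.mem_of_definable_of_finite (z := ⟨x, hN _ (hN _ hkN _ hy₀) _ (hx _ hy₀)⟩)
    (definable₁_forall_mem (k := (⟨k, hkN⟩ : N)) hk) ?_ fun y hy => hx y hy
  refine (hfin.preimage Subtype.val_injective.injOn).subset fun z hz y hy => ?_
  exact hz ⟨y, hN _ hkN _ hy⟩ hy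

end Elementary

/-! ### Cardinalities of sets and the universes `H(Θ)` -/

theorem countable_coe_iff {x : ZFSet.{u}} : (x : Set ZFSet.{u}).Countable ↔ x.card ≤ ℵ₀ := by
  rw [← le_aleph0_iff_set_countable]
  exact (congrArg (· ≤ ℵ₀) ZFSet.cardinalMk_coe_sort).to_iff.trans lift_le_aleph0

theorem exists_subset_card_eq {x : ZFSet.{u}} {c : Cardinal.{u}} (h : c ≤ x.card) :
    ∃ y, y ⊆ x ∧ y.card = c := by
  have h' : lift.{u + 1} c ≤ #(x : Set ZFSet.{u}) := by
    refine le_of_le_of_eq (lift_le.2 h) ZFSet.cardinalMk_coe_sort.symm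
  obtain ⟨p, hpx, hp⟩ := le_mk_iff_exists_subset.1 h'
  refine ⟨x.sep (· ∈ p), fun z hz => (ZFSet.mem_sep.1 hz).1, lift_injective.{u + 1} ?_⟩
  rw [← hp, ← ZFSet.cardinalMk_coe_sort]
  congr 2
  ext z
  exact ZFSet.mem_sep.trans ⟨fun hz => hz.2, fun hz => ⟨hpx hz, hz⟩⟩

theorem mem_H_of_mem {Θ : Cardinal.{u}} : ∀ y ∈ H Θ, ∀ x ∈ y, x ∈ H Θ :=
  fun _ ⟨t, ht, hyt, hc⟩ x hx => ⟨t, ht, ht x (hyt hx), hc⟩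

theorem exists_isRegular_mem_H (lam : Cardinal.{u}) (a b : ZFSet.{u}) :
    ∃ Θ : Cardinal.{u}, Θ.IsRegular ∧ lam < Θ ∧ a ∈ H Θ ∧ b ∈ H Θ := by
  set t := ZFSet.vonNeumann (max a.rank b.rank) with ht
  set c := max ℵ₀ (max lam t.card) with hc
  have htc : t.card < Order.succ c :=
    Order.lt_succ_of_le ((le_max_right _ _).trans (le_max_right _ _))
  have htr := ZFSet.isTransitive_vonNeumann (max a.rank b.rank)
  exact ⟨Order.succ c, isRegular_succ (le_max_left _ _),
    Order.lt_succ_of_le ((le_max_left _ _).trans (le_max_right _ _)),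
    ⟨t, htr, ZFSet.subset_vonNeumann.2 (le_max_left _ _), htc⟩,
    ⟨t, htr, ZFSet.subset_vonNeumann.2 (le_max_right _ _), htc⟩⟩

/-! ### Weakly uniform families and submodels -/

/-- The family `r` is `<ω`-weakly uniform: every infinite collection of sets has a finite
subcollection that is included in only finitely many members of `r`. The infinite collection need
not consist of points covered by `r`, since a point outside `⋃₀ r` lies in no member of `r`. -/
def IsWeaklyUniformFamily (r : ZFSet.{u}) : Prop :=
  ∀ A : Set ZFSet.{u}, A.Infinite → ∃ F ⊆ A, F.Finite ∧ {y | y ∈ r ∧ F ⊆ y}.Finite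

theorem IsWeaklyUniformFamily.mono {r s : ZFSet.{u}} (h : IsWeaklyUniformFamily r) (hs : s ⊆ r) :
    IsWeaklyUniformFamily s := fun A hA =>
  let ⟨F, hFA, hF, hfin⟩ := h A hA
  ⟨F, hFA, hF, hfin.subset fun _ hy => ⟨hs hy.1, hy.2⟩⟩

/-- A member of a weakly uniform family `r ∈ M` that is not in `M` meets `M` in a finite set. -/
theorem IsElementarySubmodel.finite_inter {M N : Set ZFSet.{u}} (h : IsElementarySubmodel M N)
    (hN : ∀ y ∈ N, ∀ x ∈ y, x ∈ N) {r : ZFSet.{u}} (hr : r ∈ M) (hW : IsWeaklyUniformFamily r)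
    {y : ZFSet.{u}} (hy : y ∈ r) (hyM : y ∉ M) : {x | x ∈ y ∧ x ∈ M}.Finite := by
  by_contra hinf
  obtain ⟨F, hF, hFfin, hfin⟩ := hW _ hinf
  exact hyM <| h.mem_of_finite_superset hr (fun x hx => (hF hx).2) hFfin hfin
    (hN _ (h.subset hr) _ hy) hy fun x hx => (hF hx).1

/-- A point outside a weakly `ℵ₁`-closed elementary submodel `M` lies in only countably many sets
of a weakly uniform family that are in `M`. Otherwise some countably infinite subfamily `k ∈ M`
has this point in all its members; by elementarity the intersection of `k` is then infinite, which
contradicts weak uniformity. -/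
theorem IsElementarySubmodel.countable_of_notMem {M : ZFSet.{u}} {N : Set ZFSet.{u}}
    (h : IsElementarySubmodel (M : Set ZFSet.{u}) N) (hN : ∀ y ∈ N, ∀ x ∈ y, x ∈ N)
    (hM : IsWeaklyClosedAt ℵ₁ M) {r : ZFSet.{u}} (hW : IsWeaklyUniformFamily r)
    {x : ZFSet.{u}} (hx : x ∉ M) : {y | y ∈ r ∧ y ∈ M ∧ x ∈ y}.Countable := by
  set I₀ := r.sep fun y => y ∈ M ∧ x ∈ y with hI₀
  have hI : (I₀ : Set ZFSet.{u}) = {y | y ∈ r ∧ y ∈ M ∧ x ∈ y} := by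
    ext y
    exact ZFSet.mem_sep
  rw [← hI, countable_coe_iff]
  by_contra hunc
  have hle : ℵ₁ ≤ I₀.card := by
    rw [← succ_aleph0]
    exact Order.succ_le_of_lt (not_le.1 hunc)
  obtain ⟨I, hII₀, hIc⟩ := exists_subset_card_eq hle
  have hI₀' : ∀ y ∈ I, y ∈ r ∧ y ∈ M ∧ x ∈ y := fun y hy => ZFSet.mem_sep.1 (hII₀ hy)
  obtain ⟨J, hJI, hJc, hJ⟩ := hM I (fun y hy => (hI₀' y hy).2.1) hIc
  obtain ⟨k, hkJ, hkc⟩ := exists_subset_card_eq (hJc ▸ aleph0_lt_aleph_one.le : ℵ₀ ≤ J.card)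
  have hkM : k ∈ M := hJ k hkJ (hkc ▸ aleph0_lt_aleph_one)
  have hk : ∀ y ∈ k, y ∈ r ∧ y ∈ M ∧ x ∈ y := fun y hy => hI₀' y (hJI (hkJ hy))
  have hkinf : (k : Set ZFSet.{u}).Infinite := by
    rw [← infinite_coe_iff, infinite_iff]
    refine le_of_le_of_eq ?_ ZFSet.cardinalMk_coe_sort.symm
    rw [hkc, lift_aleph0]
  have hinf : {z | ∀ y ∈ k, z ∈ y}.Infinite := fun hfin =>
    hx <| h.mem_of_finite_forall_mem hN hkM hkinf.nonempty hfin fun y hy => (hk y hy).2.2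
  obtain ⟨F, hF, -, hfin⟩ := hW _ hinf
  exact hkinf <| hfin.subset fun y hy => ⟨(hk y hy).1, fun z hz => hF hz y hy⟩

/-- Under CECA, the members of a weakly uniform family `r` can be diminished by finite sets so
that every point of `U` lies in only countably many of the diminished sets. -/
theorem CECA.exists_finite_countable (hC : CECA.{u}) (U r : ZFSet.{u})
    (hW : IsWeaklyUniformFamily r) :
    ∃ F : ZFSet.{u} → Set ZFSet.{u}, (∀ y ∈ r, (F y).Finite) ∧
      ∀ x ∈ U, {y | y ∈ r ∧ x ∈ y ∧ x ∉ F y}.Countable := by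
  induction hlam : (U ∪ r).card using WellFoundedLT.induction generalizing U r with
  | ind lam ih =>
  rcases le_or_gt lam ℵ₀ with hle | hlt
  · refine ⟨fun _ => ∅, fun _ _ => finite_empty, fun x _ => ?_⟩
    exact (countable_coe_iff.2 (hlam.trans_le hle)).mono fun y hy => ZFSet.mem_union.2 (.inr hy.1)
  -- The singleton `{r}` is used since `r` itself may have cardinality `lam`.
  obtain ⟨Θ, hΘ, hlΘ, hA, hB⟩ := exists_isRegular_mem_H lam (U ∪ r) {r}
  obtain ⟨M, hchain, hcont, hM, hrM, hcov⟩ := hC lam hlt Θ hΘ hlΘ _ _ hA hB hlam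
    (ZFSet.card_singleton.trans_lt (one_lt_aleph0.trans hlt))
  set α := lam.ord.cof.ord with hα
  have hmono : ∀ {ξ η x}, ξ ≤ η → η < α → x ∈ M ξ → x ∈ M η := by
    intro ξ η x hξ hη hx
    rcases hξ.eq_or_lt with rfl | hξ
    · exact hx
    · exact hchain.mono ξ η hξ hη hx
  have hr : ∀ ξ < α, r ∈ M ξ := fun ξ hξ =>
    (hM ξ hξ).1.mem_of_singleton_mem (mem_H_of_mem _ hB _ (ZFSet.mem_singleton.2 rfl))
      (hmono zero_le hξ hrM)
  have hIH : ∀ ξ, ∃ F : ZFSet.{u} → Set ZFSet.{u}, ξ < α → (∀ y ∈ r ∩ M ξ, (F y).Finite) ∧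
      ∀ x ∈ U ∩ M ξ, {y | y ∈ r ∩ M ξ ∧ x ∈ y ∧ x ∉ F y}.Countable := by
    intro ξ
    by_cases hξ : ξ < α
    · have hsub : U ∩ M ξ ∪ r ∩ M ξ ⊆ M ξ := fun z hz =>
        (ZFSet.mem_union.1 hz).elim (fun h => (ZFSet.mem_inter.1 h).2)
          fun h => (ZFSet.mem_inter.1 h).2
      obtain ⟨F, hF⟩ := ih _ ((ZFSet.card_mono hsub).trans_lt (hM ξ hξ).2.2)
        (U ∩ M ξ) (r ∩ M ξ) (hW.mono fun y hy => (ZFSet.mem_inter.1 hy).1) rfl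
      exact ⟨F, fun _ => hF⟩
    · exact ⟨fun _ => ∅, fun h => absurd h hξ⟩
  choose G hG using hIH
  -- `rk z` is the first index at which `z` enters the chain; by continuity it is not a limit.
  set rk : ZFSet.{u} → Ordinal.{u} := fun z => sInf {ξ | ξ < α ∧ z ∈ M ξ} with hrk
  have hrk_mem : ∀ z ∈ U ∪ r, rk z < α ∧ z ∈ M (rk z) := fun z hz =>
    csInf_mem (s := {ξ | ξ < α ∧ z ∈ M ξ}) (hcov z hz)
  have hrk_le : ∀ {z ξ}, ξ < α → z ∈ M ξ → rk z ≤ ξ := fun {z ξ} hξ hz =>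
    csInf_le' (s := {ξ | ξ < α ∧ z ∈ M ξ}) ⟨hξ, hz⟩
  -- Unless `z` enters at `0`, a single model omits `z` and includes all models before `rk z`.
  have hpred : ∀ z ∈ U ∪ r, rk z = 0 ∨
      ∃ ζ < α, z ∉ M ζ ∧ ∀ ξ < rk z, ∀ x ∈ M ξ, x ∈ M ζ := by
    intro z hz
    obtain ⟨hzα, hzM⟩ := hrk_mem z hz
    rcases Ordinal.zero_or_succ_or_isSuccLimit (rk z) with h0 | ⟨ζ, hζ⟩ | hlim
    · exact .inl h0
    · have hζz : ζ < rk z := hζ ▸ Order.lt_succ ζ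
      have hζα := hζz.trans hzα
      refine .inr ⟨ζ, hζα, fun h => (hrk_le hζα h).not_gt hζz, fun ξ hξ x hx => ?_⟩
      exact hmono (Order.lt_succ_iff.1 (hζ ▸ hξ)) hζα hx
    · obtain ⟨ξ, hξ, hzξ⟩ := (hcont _ hzα hlim z).1 hzM
      exact absurd hξ (hrk_le (hξ.trans hzα) hzξ).not_gt
  refine ⟨fun y => G (rk y) y ∪ {x | x ∈ y ∧ ∃ ξ < rk y, x ∈ M ξ}, fun y hy => ?_, fun x hx => ?_⟩
  · have hy' : y ∈ U ∪ r := ZFSet.mem_union.2 (.inr hy)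
    obtain ⟨hyα, hyM⟩ := hrk_mem y hy'
    refine ((hG _ hyα).1 y (ZFSet.mem_inter.2 ⟨hy, hyM⟩)).union ?_
    rcases hpred y hy' with h0 | ⟨ζ, hζ, hyζ, hsub⟩
    · refine finite_empty.subset ?_
      rintro x ⟨-, ξ, hξ, -⟩
      exact absurd (h0 ▸ hξ) zero_le.not_gt
    · refine ((hM ζ hζ).1.finite_inter mem_H_of_mem (hr ζ hζ) hW hy hyζ).subset ?_
      rintro x ⟨hxy, ξ, hξ, hx⟩
      exact ⟨hxy, hsub ξ hξ x hx⟩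
  · have hx' : x ∈ U ∪ r := ZFSet.mem_union.2 (.inl hx)
    obtain ⟨hxα, hxM⟩ := hrk_mem x hx'
    have hsame := (hG _ hxα).2 x (ZFSet.mem_inter.2 ⟨hx, hxM⟩)
    have hbelow : {y | y ∈ r ∧ x ∈ y ∧ rk y < rk x}.Countable := by
      rcases hpred x hx' with h0 | ⟨ζ, hζ, hxζ, hsub⟩
      · refine countable_empty.mono ?_
        rintro y ⟨-, -, hy⟩
        exact absurd (h0 ▸ hy) zero_le.not_gt
      · refine ((hM ζ hζ).1.countable_of_notMem mem_H_of_mem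
          ((hM ζ hζ).2.1 _ isRegular_aleph_one) hW hxζ).mono ?_
        rintro y ⟨hyr, hxy, hy⟩
        exact ⟨hyr, hsub _ hy y (hrk_mem y (ZFSet.mem_union.2 (.inr hyr))).2, hxy⟩
    refine (hsame.union hbelow).mono ?_
    rintro y ⟨hyr, hxy, hxF⟩
    have hyM := (hrk_mem y (ZFSet.mem_union.2 (.inr hyr))).2
    rcases lt_trichotomy (rk y) (rk x) with hlt | heq | hgt
    · exact .inr ⟨hyr, hxy, hlt⟩
    · exact .inl ⟨ZFSet.mem_inter.2 ⟨hyr, heq ▸ hyM⟩, hxy, fun h => hxF (.inl (heq ▸ h))⟩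
    · exact absurd (.inr ⟨hxy, _, hgt, hxM⟩) hxF

/-! ### Bases -/

variable {X : Type u}

/-- Under CECA, the members of a `<ω`-weakly uniform collection of subsets of a type can be
diminished by finite sets so that the result, indexed by that collection, is point-countable. -/
theorem CECA.exists_finite_countable_of_set (hC : CECA.{u}) {𝓑 : Set (Set X)}
    (hW : ∀ A : Set X, A.Infinite → ∃ F : Set X, F ⊆ A ∧ F.Finite ∧ {B | B ∈ 𝓑 ∧ F ⊆ B}.Finite) :
    ∃ F : Set X → Set X, (∀ B ∈ 𝓑, (F B).Finite) ∧
      ∀ x, {B | B ∈ 𝓑 ∧ x ∈ B ∧ x ∉ F B}.Countable := by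
  obtain ⟨e, he⟩ : ∃ e : X → ZFSet.{u}, e.Injective :=
    ⟨fun x => (Ordinal.typein WellOrderingRel x).toZFSet,
      Ordinal.toZFSet_injective.comp (Ordinal.typein_injective _)⟩
  let enc : Set X → ZFSet.{u} := fun B => ZFSet.range fun x : B => e x
  have mem_enc : ∀ {x B}, e x ∈ enc B ↔ x ∈ B := fun {x B} => by
    simp [enc, he.eq_iff]
  have enc_inj : enc.Injective := fun B C h => by
    ext x
    rw [← mem_enc, h, mem_enc]
  let r : ZFSet.{u} := ZFSet.range fun B : 𝓑 => enc B
  have mem_r : ∀ {y}, y ∈ r ↔ ∃ B ∈ 𝓑, enc B = y := by simp [r]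
  have hr : IsWeaklyUniformFamily r := by
    intro A hA
    by_cases hAe : A ⊆ range e
    · have hinf : (e ⁻¹' A).Infinite := hA.preimage hAe
      obtain ⟨F, hFA, hF, hfin⟩ := hW _ hinf
      refine ⟨e '' F, image_subset_iff.2 hFA, hF.image e, (hfin.image enc).subset ?_⟩
      rintro y ⟨hy, hFy⟩
      obtain ⟨B, hB, rfl⟩ := mem_r.1 hy
      exact ⟨B, ⟨hB, fun x hx => mem_enc.1 (hFy ⟨x, hx, rfl⟩)⟩, rfl⟩
    · obtain ⟨z, hzA, hz⟩ := not_subset.1 hAe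
      refine ⟨{z}, singleton_subset_iff.2 hzA, finite_singleton z, finite_empty.subset ?_⟩
      rintro y ⟨hy, hzy⟩
      obtain ⟨B, hB, rfl⟩ := mem_r.1 hy
      obtain ⟨x, hx⟩ := ZFSet.mem_range.1 (hzy rfl : z ∈ enc B)
      exact hz ⟨x, hx⟩
  obtain ⟨F, hF, hcount⟩ := hC.exists_finite_countable (ZFSet.range e) r hr
  refine ⟨fun B => e ⁻¹' F (enc B),
    fun B hB => (hF _ (mem_r.2 ⟨B, hB, rfl⟩)).preimage he.injOn, fun x => ?_⟩
  refine ((hcount (e x) (ZFSet.mem_range_self x)).preimage_of_injOn enc_inj.injOn).mono ?_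
  rintro B ⟨hB, hxB, hxF⟩
  exact ⟨mem_r.2 ⟨B, hB, rfl⟩, mem_enc.2 hxB, hxF⟩

variable [TopologicalSpace X] [T1Space X]

/-- A `<ω`-weakly uniform base is point-countable at each cluster point `x` of a countable set `C`:
every member that contains `x` has an infinite trace on `C`, so it includes one of the countably
many finite subsets of `C` that lie in only finitely many members. -/
theorem IsLtOmegaWeaklyUniformBase.countable_of_accPt {𝓑 : Set (Set X)}
    (h : IsLtOmegaWeaklyUniformBase 𝓑) {x : X} {C : Set X} (hC : C.Countable)
    (hx : AccPt x (Filter.principal C)) : {B | B ∈ 𝓑 ∧ x ∈ B}.Countable := by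
  have hcount : {F : Set X | F ⊆ C ∧ F.Finite ∧ {B | B ∈ 𝓑 ∧ F ⊆ B}.Finite}.Countable :=
    (countable_ofPred_finite_subset hC).mono fun F (hF : _ ∧ _ ∧ _) => And.intro hF.2.1 hF.1
  refine (hcount.biUnion fun F hF => hF.2.2.countable).mono ?_
  rintro B ⟨hB, hxB⟩
  have hinf : (B ∩ C).Infinite := by
    have hacc := hx.nhds_inter ((h.isBase.isOpen hB).mem_nhds hxB)
    rw [accPt_iff_frequently_nhdsNE] at hacc
    exact Filter.frequently_cofinite_iff_infinite.1 (hacc.filter_mono (nhdsNE_le_cofinite x))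
  obtain ⟨F, hF, hFfin, hfin⟩ := h.weaklyUniform _ hinf
  exact mem_iUnion₂.2 ⟨F, ⟨fun z hz => (hF hz).2, hFfin, hfin⟩, hB, fun z hz => (hF hz).1⟩

/-- Removing finitely many isolated points from each member of a base and adding the isolated
points as singletons yields a base again. -/
theorem isTopologicalBasis_diff_isolated {𝓑 : Set (Set X)}
    (h : TopologicalSpace.IsTopologicalBasis 𝓑) {F : Set X → Set X}
    (hF : ∀ B ∈ 𝓑, (F B).Finite) (hiso : ∀ B ∈ 𝓑, ∀ x ∈ F B, IsOpen ({x} : Set X)) :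
    TopologicalSpace.IsTopologicalBasis
      ((fun B => B \ F B) '' 𝓑 ∪ {S | ∃ x, IsOpen ({x} : Set X) ∧ S = {x}}) := by
  refine TopologicalSpace.isTopologicalBasis_of_isOpen_of_nhds ?_ fun x U hx hU => ?_
  · rintro S (⟨B, hB, rfl⟩ | ⟨x, hx, rfl⟩)
    · exact (h.isOpen hB).sdiff (hF B hB).isClosed
    · exact hx
  · by_cases hxo : IsOpen ({x} : Set X)
    · exact ⟨{x}, .inr ⟨x, hxo, rfl⟩, rfl, singleton_subset_iff.2 hx⟩
    · obtain ⟨B, hB, hxB, hBU⟩ := h.exists_subset_of_mem_open hx hU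
      exact ⟨B \ F B, .inl ⟨B, hB, rfl⟩, ⟨hxB, fun hxF => hxo (hiso B hB x hxF)⟩,
        sdiff_subset.trans hBU⟩

end WeaklyUniform

theorem theorem4p3 (hCECA : WeaklyUniform.CECA.{u})
    {X : Type u} [TopologicalSpace X] [T1Space X]
    (hX : ∀ x : X, ¬ IsOpen ({x} : Set X) →
      ∃ C : Set X, C.Countable ∧ AccPt x (Filter.principal C))
    (hB : ∃ 𝓑 : Set (Set X), WeaklyUniform.IsLtOmegaWeaklyUniformBase 𝓑) :
    ∃ 𝓑 : Set (Set X), WeaklyUniform.IsPointCountableBase 𝓑 := by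
  obtain ⟨𝓑, h⟩ := hB
  obtain ⟨F, hF, hcount⟩ := hCECA.exists_finite_countable_of_set h.weaklyUniform
  -- Only isolated points are removed, so that the neighborhoods of the other points survive.
  let F' : Set X → Set X := fun B => F B ∩ {x | IsOpen ({x} : Set X)}
  refine ⟨_, WeaklyUniform.isTopologicalBasis_diff_isolated (F := F') h.isBase
    (fun B hB => (hF B hB).inter_of_left _) fun B _ x hx => hx.2, fun x => ?_⟩
  have hx : {B | B ∈ 𝓑 ∧ x ∈ B \ F' B}.Countable := by
    by_cases hxo : IsOpen ({x} : Set X)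
    · exact (hcount x).mono fun B (hB : _ ∧ _ ∧ _) =>
        And.intro hB.1 ⟨hB.2.1, fun hxF => hB.2.2 ⟨hxF, hxo⟩⟩
    · obtain ⟨C, hC, hxC⟩ := hX x hxo
      exact (h.countable_of_accPt hC hxC).mono fun B (hB : _ ∧ _ ∧ _) =>
        And.intro hB.1 hB.2.1
  refine ((hx.image fun B => B \ F' B).union (Set.countable_singleton {x})).mono ?_
  rintro S ⟨⟨B, hB, rfl⟩ | ⟨z, -, rfl⟩, hxS⟩
  · exact .inl ⟨B, ⟨hB, hxS⟩, rfl⟩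
  · exact .inr (congrArg _ (Set.mem_singleton_iff.1 hxS).symm)
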